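/- Let $p$ be a prime and let $G$ be a finite group. Let $O_{p'}(G)$ and $O_p(G)$ denote the largest normal subgroup of $G$ of order prime to $p$ and the largest normal $p$-subgroup of $G$, let $O_{p',p}(G)$ be the preimage in $G$ of $O_p(G/O_{p'}(G))$, and let $O_{p',p,p'}(G)$ be the preimage in $G$ of $O_{p'}(G/O_{p',p}(G))$. Let $\operatorname{IBr}_p(G)$ be the set of irreducible $p$-Brauer characters of $G$, i.e. the Brauer characters of the irreducible representations of $G$ over an algebraically closed field $F$ of characteristic $p$, formed with respect to an injective homomorphism from the group of roots of unity of $F$ to $\mathbb{C}^\times$. Assume that $G=O_{p',p,p'}(G)$. Then $\varphi(1)$ is a power of $p$ (possibly $p^0=1$) for every $\varphi\in\operatorname{IBr}_p(G)$ if and only if the following two conditions are satisfied. (a) All $p'$-sections of $G$ are abelian. Here a $p'$-section is a group obtained from $G$ by repeatedly passing to normal subgroups and quotients and having order prime to $p$; that is, a quotient $H/K$ of order prime to $p$, where $H$ is a subnormal subgroup of $G$ and $K$ is a normal subgroup of $H$. (b) $G=C_G(x)\,O_{p',p}(G)$ for all $x\in O_{p'}(G)$. Moreover, the same equivalence holds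 if in (a) only the quotients $H/K$ of order prime to $p$ with both $H$ and $K$ normal in $G$ are required to be abelian. -/

import Mathlib

/-- `O_{p'}(G)`: the largest normal subgroup of `G` of order prime to `p`, for `G` finite. -/
def pPrimeCore (p : ℕ) (G : Type*) [Group G] : Subgroup G :=
  sSup {N : Subgroup G | N.Normal ∧ (Nat.card N).Coprime p}

/-- `O_p(G)`: the largest normal `p`-subgroup of `G`, for `G` finite. -/
def pCore (p : ℕ) (G : Type*) [Group G] : Subgroup G :=
  sSup {N : Subgroup G | N.Normal ∧ IsPGroup p N}

instance pPrimeCore_normal (p : ℕ) (G : Type*) [Group G] : (pPrimeCore p G).Normal :=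
  Subgroup.sSup_normal _ fun _ hN => hN.1

instance pCore_normal (p : ℕ) (G : Type*) [Group G] : (pCore p G).Normal :=
  Subgroup.sSup_normal _ fun _ hN => hN.1

/-- `O_{p',p}(G)`: the preimage in `G` of `O_p(G / O_{p'}(G))`. -/
def pPrimePCore (p : ℕ) (G : Type*) [Group G] : Subgroup G :=
  (pCore p (G ⧸ pPrimeCore p G)).comap (QuotientGroup.mk' (pPrimeCore p G))

instance pPrimePCore_normal (p : ℕ) (G : Type*) [Group G] : (pPrimePCore p G).Normal :=
  Subgroup.Normal.comap (pCore_normal p _) _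

/-- `O_{p',p,p'}(G)`: the preimage in `G` of `O_{p'}(G / O_{p',p}(G))`. -/
def pPrimePPPrimeCore (p : ℕ) (G : Type*) [Group G] : Subgroup G :=
  (pPrimeCore p (G ⧸ pPrimePCore p G)).comap (QuotientGroup.mk' (pPrimePCore p G))

/-- The section `H / K` is an abelian group (if it has order prime to `p`). -/
def PPrimeSectionAbelian (p : ℕ) {G : Type*} [Group G] (H K : Subgroup G)
    [(K.subgroupOf H).Normal] : Prop :=
  (Nat.card (H ⧸ K.subgroupOf H)).Coprime p →
    ∀ a b : H ⧸ K.subgroupOf H, a * b = b * a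

/-- All `p'`-sections `H / K` of `G` with `H` subnormal in `G` and `K` normal in `H` are abelian.
These are the `p'`-groups obtained from `G` by repeatedly passing to normal subgroups and
quotients. -/
def SubnormalPPrimeSectionsAbelian (p : ℕ) (G : Type*) [Group G] : Prop :=
  ∀ H K : Subgroup G, H.IsSubnormal → K ≤ H → ∀ _ : (K.subgroupOf H).Normal,
    PPrimeSectionAbelian p H K

/-- All `p'`-sections `H / K` of `G` with `H` and `K` normal in `G` are abelian. -/
def NormalPPrimeSectionsAbelian (p : ℕ) (G : Type*) [Group G] : Prop :=
  ∀ H K : Subgroup G, H.Normal → K.Normal → K ≤ H → ∀ _ : (K.subgroupOf H).Normal,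
    PPrimeSectionAbelian p H K

open scoped Pointwise in
/-- `G = C_G(x) O_{p',p}(G)` (product of subsets) for all `x` in `O_{p'}(G)`. -/
def EqCentralizerMulPPrimePCore (p : ℕ) (G : Type*) [Group G] : Prop :=
  ∀ x ∈ pPrimeCore p G,
    (Subgroup.centralizer {x} : Set G) * (pPrimePCore p G : Set G) = Set.univ

/-- The `p`-regular elements of a finite group: those of order prime to `p`. -/
def PRegular (p : ℕ) (G : Type*) [Group G] : Type _ :=
  {g : G // (orderOf g).Coprime p}

instance (p : ℕ) (G : Type*) [Group G] : One (PRegular p G) :=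
  ⟨⟨1, by simp⟩⟩

open Classical in
/-- A homomorphism `θ` from the roots of unity of `F` to those of `ℂ`, as a map `F → ℂ`
(extended by zero; only its values at roots of unity matter). -/
noncomputable def liftRoot {F : Type*} [Field F] (θ : CommGroup.torsion Fˣ →* ℂˣ) (a : F) : ℂ :=
  if h : ∃ u : CommGroup.torsion Fˣ, ((u : Fˣ) : F) = a then ((θ h.choose : ℂˣ) : ℂ) else 0

/-- The Brauer character of a representation `ρ` over an algebraically closed field `F` of
characteristic `p`: at a `p`-regular `g`, the sum of the lifts to `ℂ` of the eigenvalues of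
`ρ g`, counted with (algebraic) multiplicity. -/
noncomputable def brauerCharacter (p : ℕ) {G F V : Type*} [Group G] [Field F]
    [AddCommGroup V] [Module F V] [FiniteDimensional F V]
    (θ : CommGroup.torsion Fˣ →* ℂˣ) (ρ : Representation F G V) : PRegular p G → ℂ :=
  fun g => ((ρ g.1).charpoly.roots.map (liftRoot θ)).sum

/-- `IBr_p(G)`: the Brauer characters of the irreducible (matrix) representations of `G`
over `F`. -/
def IBr (p : ℕ) (G : Type*) {F : Type*} [Group G] [Field F]
    (θ : CommGroup.torsion Fˣ →* ℂˣ) : Set (PRegular p G → ℂ) :=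
  {φ | ∃ (n : ℕ) (ρ : Representation F G (Fin n → F)),
    ρ.IsIrreducible ∧ φ = brauerCharacter p θ ρ}

/-! Brauer characters enter only through their degrees: the claim concerns the dimensions of
irreducible representations over `F`. Write N = O_{p'}(G) and M = O_{p',p}(G), so that M/N is a
p-group and G/M a p'-group.

Suppose all dimensions are powers of p. By Clifford theory this passes to normal subgroups, and it
clearly passes to quotients. In a p'-group the dimensions are nonzero in `F`, so they are all 1, and
semisimplicity makes the group abelian; this gives (a). In particular N is abelian. Each character χ
of N occurs in some irreducible representation, whose dimension is the orbit length of χ times the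
dimension of the χ-weight space. So the orbit has p-power length, and since |G:M| is prime to p, M
is already transitive on it. Brauer's permutation lemma carries the equality of G-orbits and
M-orbits from characters to elements of N, which is (b).

Conversely, let χ be a weight of an irreducible V and T its stabilizer. By (b) and Brauer's lemma
the orbit of χ has p-power length |G:T|, which is a lower bound for dim V. For the upper bound a
common eigenvector of T suffices. The vectors of weight χ fixed by all p-elements of M ∩ T form a
nonzero T-space W on which M ∩ T acts by a character μ. A transfer argument compares a power of μ
with characters of M and of T. Together with (a) it shows that commutators of T act trivially on W,
so T has an eigenvector there. -/

section

open Module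

/-! ### Invariant subspaces and Schur's lemma. -/

namespace Representation

variable {F G V U : Type*} [Field F] [Group G] [AddCommGroup V] [Module F V]
  [AddCommGroup U] [Module F U]

/-- A submodule that is stable under a representation. -/
def IsInvariant (ρ : Representation F G V) (W : Submodule F V) : Prop :=
  ∀ g, ∀ w ∈ W, ρ g w ∈ W

/-- A minimal nonzero invariant submodule. -/
structure IsMinimalInvariant (ρ : Representation F G V) (W : Submodule F V) : Prop where
  ne_bot : W ≠ ⊥
  inv : ρ.IsInvariant W
  eq_or_eq : ∀ W' ≤ W, ρ.IsInvariant W' → W' = ⊥ ∨ W' = W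

theorem isIrreducible_iff_forall_isInvariant (ρ : Representation F G V) :
    ρ.IsIrreducible ↔ Nontrivial V ∧ ∀ W, ρ.IsInvariant W → W = ⊥ ∨ W = ⊤ := by
  constructor
  · intro h
    refine ⟨?_, fun W hW => ?_⟩
    · by_contra hn
      rw [not_nontrivial_iff_subsingleton] at hn
      obtain ⟨x, y, hxy⟩ := h.exists_pair_ne
      exact hxy (Subrepresentation.toSubmodule_injective (Subsingleton.elim _ _))
    · rcases h.eq_bot_or_eq_top ⟨W, hW⟩ with h1 | h1
      · exact Or.inl (congrArg Subrepresentation.toSubmodule h1)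
      · exact Or.inr (congrArg Subrepresentation.toSubmodule h1)
  · rintro ⟨hn, h⟩
    have : Nontrivial (Subrepresentation ρ) := by
      refine ⟨⊥, ⊤, fun he => ?_⟩
      exact bot_ne_top (α := Submodule F V) (congrArg Subrepresentation.toSubmodule he)
    refine ⟨fun W => ?_⟩
    rcases h W.toSubmodule W.apply_mem_toSubmodule with h1 | h1
    · exact Or.inl (Subrepresentation.toSubmodule_injective h1)
    · exact Or.inr (Subrepresentation.toSubmodule_injective h1)

theorem IsInvariant.inf {ρ : Representation F G V} {W W' : Submodule F V}
    (h : ρ.IsInvariant W) (h' : ρ.IsInvariant W') : ρ.IsInvariant (W ⊓ W') :=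
  fun g w hw => ⟨h g w hw.1, h' g w hw.2⟩

theorem IsInvariant.sup {ρ : Representation F G V} {W W' : Submodule F V}
    (h : ρ.IsInvariant W) (h' : ρ.IsInvariant W') : ρ.IsInvariant (W ⊔ W') := by
  intro g w hw
  obtain ⟨x, hx, y, hy, rfl⟩ := Submodule.mem_sup.1 hw
  rw [map_add]
  exact Submodule.add_mem_sup (h g x hx) (h' g y hy)

theorem exists_isMinimalInvariant_le [FiniteDimensional F V] (ρ : Representation F G V)
    (C : Submodule F V) (hC : ρ.IsInvariant C) (h0 : C ≠ ⊥) :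
    ∃ W ≤ C, ρ.IsMinimalInvariant W := by
  obtain ⟨W, ⟨h1, h2, h3⟩, hmin⟩ := (wellFounded_lt (α := Submodule F V)).has_min
    {W | W ≤ C ∧ ρ.IsInvariant W ∧ W ≠ ⊥} ⟨C, le_rfl, hC, h0⟩
  refine ⟨W, h1, h3, h2, fun W' hle hinv => ?_⟩
  by_cases hb : W' = ⊥
  · exact Or.inl hb
  · right
    by_contra hne
    exact hmin W' ⟨hle.trans h1, hinv, hb⟩ (lt_of_le_of_ne hle hne)

theorem IsMinimalInvariant.isIrreducible {ρ : Representation F G V} {W : Submodule F V}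
    (h : ρ.IsMinimalInvariant W) :
    (Subrepresentation.toRepresentation (ρ := ρ) ⟨W, h.inv⟩).IsIrreducible := by
  rw [isIrreducible_iff_forall_isInvariant]
  refine ⟨Submodule.nontrivial_iff_ne_bot.2 h.ne_bot, fun Y hY => ?_⟩
  have hinv : ρ.IsInvariant (Y.map W.subtype) := by
    rintro g _ ⟨y, hy, rfl⟩
    exact ⟨_, hY g y hy, rfl⟩
  rcases h.eq_or_eq (Y.map W.subtype) (Submodule.map_subtype_le _ _) hinv with h1 | h1
  · left
    apply Submodule.map_injective_of_injective W.injective_subtype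
    rw [h1, Submodule.map_bot]
  · right
    apply Submodule.map_injective_of_injective W.injective_subtype
    rw [h1, Submodule.map_top, Submodule.range_subtype]

/-- Schur's lemma. -/
theorem IsIrreducible.exists_eq_smul [IsAlgClosed F] [FiniteDimensional F V]
    {ρ : Representation F G V} (h : ρ.IsIrreducible) (S : V →ₗ[F] V)
    (hS : ∀ g v, S (ρ g v) = ρ g (S v)) : ∃ c : F, ∀ v, S v = c • v := by
  rw [isIrreducible_iff_forall_isInvariant] at h
  obtain ⟨hn, h⟩ := h
  obtain ⟨c, hc⟩ := Module.End.exists_eigenvalue S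
  refine ⟨c, fun v => ?_⟩
  have hinv : ρ.IsInvariant (Module.End.eigenspace S c) := fun g w hw => by
    rw [Module.End.mem_eigenspace_iff] at hw ⊢
    rw [hS, hw, map_smul]
  rcases h _ hinv with h1 | h1
  · exact absurd h1 hc
  · exact Module.End.mem_eigenspace_iff.1 (h1 ▸ Submodule.mem_top)

/-- In a space where a family of operators commutes there is a common eigenvector. -/
theorem exists_common_eigenvector [IsAlgClosed F] [FiniteDimensional F V]
    (ρ : Representation F G V) (C : Submodule F V) (hC : ρ.IsInvariant C) (h0 : C ≠ ⊥)
    (hcomm : ∀ a b, ∀ w ∈ C, ρ a (ρ b w) = ρ b (ρ a w)) :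
    ∃ w ∈ C, w ≠ 0 ∧ ∀ g, ∃ c : F, ρ g w = c • w := by
  obtain ⟨W, hWC, hW⟩ := exists_isMinimalInvariant_le ρ C hC h0
  obtain ⟨w, hw, hw0⟩ := (Submodule.ne_bot_iff _).1 hW.ne_bot
  refine ⟨w, hWC hw, hw0, fun g => ?_⟩
  obtain ⟨c, hc⟩ := hW.isIrreducible.exists_eq_smul ((ρ g).restrict (hW.inv g)) fun a v => by
    ext
    exact hcomm g a v (hWC v.2)
  exact ⟨c, congrArg Subtype.val (hc ⟨w, hw⟩)⟩

/-! ### Clifford theory and coinduced representations. -/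

section Clifford

variable {H : Subgroup G}

theorem IsInvariant.map_of_normal [hH : H.Normal] {ρ : Representation F G V} {W : Submodule F V}
    (hW : IsInvariant (ρ.comp H.subtype) W) (g : G) :
    IsInvariant (ρ.comp H.subtype) (W.map (ρ g)) := by
  rintro h _ ⟨w, hw, rfl⟩
  refine ⟨_, hW ⟨g⁻¹ * h * g, by simpa using hH.conj_mem h h.2 g⁻¹⟩ w hw, ?_⟩
  change ρ g (ρ (g⁻¹ * h * g) w) = ρ h (ρ g w)
  rw [← Module.End.mul_apply, ← Module.End.mul_apply, ← map_mul, ← map_mul]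
  congr 2
  group

theorem IsMinimalInvariant.map_of_normal [hH : H.Normal] {ρ : Representation F G V}
    {W : Submodule F V} (hW : IsMinimalInvariant (ρ.comp H.subtype) W) (g : G) :
    IsMinimalInvariant (ρ.comp H.subtype) (W.map (ρ g)) := by
  have hinj : ∀ a : G, Function.Injective (ρ a) := fun a => (ρ.apply_bijective a).injective
  have hback : ∀ Y : Submodule F V, (Y.map (ρ g⁻¹)).map (ρ g) = Y := fun Y => by
    rw [← Submodule.map_comp, ← Module.End.mul_eq_comp, ← map_mul, mul_inv_cancel, map_one]
    exact Submodule.map_id _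
  refine ⟨?_, hW.inv.map_of_normal g, fun Y hY hinv => ?_⟩
  · intro h
    exact hW.ne_bot (Submodule.map_injective_of_injective (hinj g) (h.trans (Submodule.map_bot _).symm))
  · have hle : Y.map (ρ g⁻¹) ≤ W := by
      apply (Submodule.map_le_map_iff_of_injective (hinj g) _ _).1
      rwa [hback]
    rcases hW.eq_or_eq _ hle (hinv.map_of_normal g⁻¹) with h | h
    · left
      rw [← hback Y, h, Submodule.map_bot]
    · right
      rw [← hback Y, h]

/-- Every translate of W is again minimal, so it either lies in the sum built so far or meets it in
zero. Each step thus adds 0 or dim W to the dimension. -/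
theorem finrank_dvd_finrank_iSup_map [H.Normal] [FiniteDimensional F V]
    {ρ : Representation F G V} {W : Submodule F V}
    (hW : IsMinimalInvariant (ρ.comp H.subtype) W) (s : Finset G) :
    IsInvariant (ρ.comp H.subtype) (s.sup fun g => W.map (ρ g)) ∧
      finrank F W ∣ finrank F (s.sup fun g => W.map (ρ g) : Submodule F V) := by
  classical
  induction s using Finset.induction_on with
  | empty =>
    refine ⟨fun g w hw => ?_, ?_⟩
    · rw [Finset.sup_empty, Submodule.mem_bot] at *
      rw [hw, map_zero]
    · rw [Finset.sup_empty, finrank_bot]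
      exact dvd_zero _
  | insert g s _ ih =>
    obtain ⟨hinv, hdvd⟩ := ih
    rw [Finset.sup_insert]
    have hg := hW.map_of_normal g
    refine ⟨hg.inv.sup hinv, ?_⟩
    have hrank := Submodule.finrank_sup_add_finrank_inf_eq (W.map (ρ g))
      (s.sup fun g => W.map (ρ g))
    have hfg : finrank F (W.map (ρ g)) = finrank F W :=
      (Submodule.equivMapOfInjective _ (ρ.apply_bijective g).injective W).finrank_eq.symm
    rcases hg.eq_or_eq _ inf_le_left (hg.inv.inf hinv) with h | h
    · rw [h, finrank_bot, add_zero, hfg] at hrank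
      rw [hrank]
      exact dvd_add dvd_rfl hdvd
    · rwa [sup_eq_right.2 (inf_eq_left.1 h)]

theorem IsIrreducible.sup_map_eq_top [Fintype G] {ρ : Representation F G V} (hρ : ρ.IsIrreducible)
    {W : Submodule F V} (hW : W ≠ ⊥) :
    (Finset.univ.sup fun g => W.map (ρ g)) = ⊤ := by
  rw [isIrreducible_iff_forall_isInvariant] at hρ
  refine (hρ.2 _ fun g w hw => ?_).resolve_left fun h => hW ?_
  · have hle : (Finset.univ.sup fun g => W.map (ρ g)) ≤
        (Finset.univ.sup fun g => W.map (ρ g)).comap (ρ g) := by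
      refine Finset.sup_le fun a _ => ?_
      rintro _ ⟨w, hw, rfl⟩
      refine (Finset.le_sup (f := fun g => W.map (ρ g)) (Finset.mem_univ (g * a))) ⟨w, hw, ?_⟩
      rw [map_mul, Module.End.mul_apply]
    exact hle hw
  · have := Finset.le_sup (f := fun g => W.map (ρ g)) (Finset.mem_univ (1 : G))
    rw [h, map_one] at this
    rw [eq_bot_iff]
    intro w hw
    exact this ⟨w, hw, rfl⟩

/-- Clifford's theorem for an irreducible quotient `U` of the restriction to a normal subgroup. -/
theorem IsIrreducible.clifford [H.Normal] [Finite G] [FiniteDimensional F V]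
    {ρ : Representation F G V} (hρ : ρ.IsIrreducible) {σ : Representation F H U}
    (hσ : σ.IsIrreducible) (f : V →ₗ[F] U) (hf : ∀ (h : H) v, f (ρ h v) = σ h (f v))
    (hf0 : f ≠ 0) :
    finrank F U ∣ finrank F V ∧
      ∃ W : Submodule F V, IsInvariant (ρ.comp H.subtype) W ∧
        (∀ w ∈ W, f w = 0 → w = 0) ∧ ∀ u, ∃ w ∈ W, f w = u := by
  have := Fintype.ofFinite G
  rw [isIrreducible_iff_forall_isInvariant] at hσ
  have hVn := ((isIrreducible_iff_forall_isInvariant ρ).1 hρ).1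
  obtain ⟨W, -, hW⟩ := exists_isMinimalInvariant_le (ρ.comp H.subtype) ⊤
    (fun _ _ _ => Submodule.mem_top) top_ne_bot
  have htop := hρ.sup_map_eq_top hW.ne_bot
  -- The translates of W span V and `f` is nonzero, so some translate is not killed. As in Schur's
  -- lemma, minimality there and irreducibility of `σ` make `f` an isomorphism from it onto U.
  obtain ⟨g, hg⟩ : ∃ g, ¬ W.map (ρ g) ≤ LinearMap.ker f := by
    by_contra! hcon
    apply hf0
    rw [← LinearMap.ker_eq_top, eq_top_iff, ← htop]
    exact Finset.sup_le fun g _ => hcon g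
  have hgW := hW.map_of_normal g
  have hker : IsInvariant (ρ.comp H.subtype) (LinearMap.ker f) := fun h w hw => by
    rw [LinearMap.mem_ker] at hw ⊢
    rw [MonoidHom.comp_apply, Subgroup.subtype_apply, hf, hw, map_zero]
  have hdisj : W.map (ρ g) ⊓ LinearMap.ker f = ⊥ :=
    (hgW.eq_or_eq _ inf_le_left (hgW.inv.inf hker)).resolve_right fun h => hg (inf_eq_left.1 h)
  have hinj : ∀ w ∈ W.map (ρ g), f w = 0 → w = 0 := fun w hw h0 => by
    have : w ∈ W.map (ρ g) ⊓ LinearMap.ker f := ⟨hw, h0⟩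
    rwa [hdisj, Submodule.mem_bot] at this
  have hsurj : (W.map (ρ g)).map f = ⊤ := by
    refine (hσ.2 _ ?_).resolve_left fun h => hg ?_
    · rintro h _ ⟨w, hw, rfl⟩
      exact ⟨_, hgW.inv h w hw, hf h w⟩
    · exact fun w hw => (Submodule.mem_bot F).1 (h ▸ Submodule.mem_map_of_mem hw)
  refine ⟨?_, W.map (ρ g), hgW.inv, hinj, fun u => ?_⟩
  · have h1 := (finrank_dvd_finrank_iSup_map hW Finset.univ).2
    rw [htop, finrank_top] at h1
    have h2 : finrank F (W.map (ρ g)) = finrank F W :=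
      (Submodule.equivMapOfInjective _ (ρ.apply_bijective g).injective W).finrank_eq.symm
    have h3 : finrank F ((W.map (ρ g)).map f) = finrank F (W.map (ρ g)) := by
      apply LinearEquiv.finrank_eq
      refine (LinearEquiv.ofBijective ((f.domRestrict (W.map (ρ g))).codRestrict
        ((W.map (ρ g)).map f) fun w => ⟨w, w.2, rfl⟩) ⟨?_, ?_⟩).symm
      · rw [injective_iff_map_eq_zero]
        intro w hw
        ext
        exact hinj w w.2 (congrArg Subtype.val hw)
      · rintro ⟨_, w, hw, rfl⟩
        exact ⟨⟨w, hw⟩, rfl⟩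
    rw [hsurj, finrank_top] at h3
    rwa [h3, h2]
  · have : u ∈ (W.map (ρ g)).map f := hsurj ▸ Submodule.mem_top
    exact this

end Clifford

/-- Every irreducible representation of a subgroup is a quotient of the restriction of an
irreducible representation of the group. -/
theorem exists_isIrreducible_of_subgroup {F : Type*} {G : Type*} {U : Type*} [Field F] [Group G]
    [Finite G] [AddCommGroup U] [Module F U] [FiniteDimensional F U] {H : Subgroup G}
    {σ : Representation F H U} (hσ : σ.IsIrreducible) :
    ∃ (W : Submodule F (G → U)) (ρ : Representation F G W) (f : W →ₗ[F] U), ρ.IsIrreducible ∧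
      (∀ (h : H) v, f (ρ h v) = σ h (f v)) ∧ f ≠ 0 := by
  classical
  let τ : Representation F G (G → U) :=
    { toFun := fun g => LinearMap.funLeft F U fun x => x * g
      map_one' := by ext; simp [LinearMap.funLeft]
      map_mul' := fun a b => by ext; simp [LinearMap.funLeft, mul_assoc] }
  have hτ : ∀ g f x, τ g f x = f (x * g) := fun _ _ _ => rfl
  -- The coinduced module inside the functions from G to U under right translation. The map to U
  -- will be evaluation at 1.
  let C : Submodule F (G → U) :=
    { carrier := {f | ∀ (h : H) x, f (h * x) = σ h (f x)}
      add_mem' := fun ha hb h x => by simp [ha h x, hb h x]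
      zero_mem' := fun h x => by simp
      smul_mem' := fun c f hf h x => by simp [hf h x] }
  have hC : τ.IsInvariant C := fun g f hf h x => by
    rw [hτ, hτ, mul_assoc, hf]
  have hn := ((isIrreducible_iff_forall_isInvariant σ).1 hσ).1
  obtain ⟨u, hu⟩ := exists_ne (0 : U)
  have hC0 : C ≠ ⊥ := by
    rw [Submodule.ne_bot_iff]
    refine ⟨fun x => if hx : x ∈ H then σ ⟨x, hx⟩ u else 0, fun h x => ?_, fun h0 => hu ?_⟩
    · beta_reduce
      by_cases hx : x ∈ H
      · rw [dif_pos hx, dif_pos (H.mul_mem h.2 hx), ← Module.End.mul_apply, ← map_mul]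
        rfl
      · rw [dif_neg hx, dif_neg, map_zero]
        rwa [H.mul_mem_cancel_left h.2]
    · have := congrFun h0 1
      rw [dif_pos H.one_mem] at this
      simpa [show (⟨1, H.one_mem⟩ : H) = 1 from rfl] using this
  obtain ⟨W, hWC, hW⟩ := exists_isMinimalInvariant_le τ C hC hC0
  refine ⟨W, _, (LinearMap.proj 1).comp W.subtype, hW.isIrreducible, fun h v => ?_, fun h0 => ?_⟩
  · have := hWC v.2 h 1
    change v.1 (1 * h) = σ h (v.1 1)
    rw [one_mul, ← this, mul_one]
  · apply hW.ne_bot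
    rw [Submodule.eq_bot_iff]
    intro w hw
    funext x
    -- The value of w at x is the value at 1 of its translate by x, so evaluation at 1 cannot vanish
    -- on a nonzero invariant subspace.
    have := LinearMap.congr_fun h0 ⟨_, hW.inv x w hw⟩
    change w (1 * x) = 0 at this
    rwa [one_mul] at this

end Representation

end

/-! ### Fixed vectors of p-groups, and weight spaces of a normal subgroup. -/

section

open Module

namespace Representation

variable {F G V : Type*} [Field F] [Group G] [AddCommGroup V] [Module F V]

/-- Averaging a rank-one operator A with nonzero trace over conjugation by G gives a scalar c by
Schur. Comparing traces, c · dim V = |G| · tr A, which is nonzero. -/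
theorem IsIrreducible.finrank_cast_ne_zero [Finite G] [IsAlgClosed F] [FiniteDimensional F V]
    {ρ : Representation F G V} (hρ : ρ.IsIrreducible) (hG : (Nat.card G : F) ≠ 0) :
    (finrank F V : F) ≠ 0 := by
  have := Fintype.ofFinite G
  have hn := ((isIrreducible_iff_forall_isInvariant ρ).1 hρ).1
  obtain ⟨v, hv⟩ := exists_ne (0 : V)
  obtain ⟨φ, hφ⟩ := Module.Projective.exists_dual_ne_zero F hv
  set A : V →ₗ[F] V := φ.smulRight v
  set S : V →ₗ[F] V := ∑ g : G, ρ g * A * ρ g⁻¹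
  have hS : ∀ g v, S (ρ g v) = ρ g (S v) := by
    intro g v
    simp only [S, LinearMap.sum_apply, map_sum]
    refine Fintype.sum_equiv (Equiv.mulLeft g⁻¹) _ _ fun a => ?_
    simp only [Equiv.coe_mulLeft, Module.End.mul_apply, ← Module.End.mul_apply (ρ _) (ρ _),
      ← map_mul]
    simp
  obtain ⟨c, hc⟩ := hρ.exists_eq_smul S hS
  have hSc : S = c • LinearMap.id := LinearMap.ext hc
  have htr : LinearMap.trace F V S = Nat.card G * φ v := by
    simp only [S, map_sum]
    rw [Finset.sum_congr rfl fun g _ => ?_, Finset.sum_const, Finset.card_univ,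
      Nat.card_eq_fintype_card, nsmul_eq_mul]
    rw [LinearMap.trace_mul_comm, ← mul_assoc, ← map_mul, inv_mul_cancel, map_one, one_mul]
    exact LinearMap.trace_smulRight _ _
  rw [hSc, map_smul, LinearMap.trace_id] at htr
  intro h0
  rw [h0, smul_zero] at htr
  exact mul_ne_zero hG hφ htr.symm

/-- A `p`-group acting in characteristic `p` fixes a nonzero vector. -/
theorem exists_fixed_vector (p : ℕ) [Fact p.Prime] [CharP F p] [Finite G] (hG : IsPGroup p G)
    (ρ : Representation F G V) {C : Submodule F V} (hC : ρ.IsInvariant C) (h0 : C ≠ ⊥) :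
    ∃ w ∈ C, w ≠ 0 ∧ ∀ g, ρ g w = w := by
  have := Fintype.ofFinite G
  obtain ⟨w, hw, hw0⟩ := (Submodule.ne_bot_iff _).1 h0
  let c : ZMod p →+* F := ZMod.castHom dvd_rfl F
  -- The field may be infinite, so fixed points are counted in the finite span over `ZMod p` of the
  -- orbit of w. There p divides the order and 0 is fixed, so a second fixed point exists.
  let Φ : (G → ZMod p) →+ V :=
    { toFun := fun f => ∑ g, c (f g) • ρ g w
      map_zero' := by simp
      map_add' := fun a b => by simp [add_smul, Finset.sum_add_distrib] }
  have hΦ : ∀ f, Φ f = ∑ g, c (f g) • ρ g w := fun _ => rfl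
  have hfin : Finite Φ.range := Set.finite_range Φ
  have hmem : ∀ g, ∀ v ∈ Φ.range, ρ g v ∈ Φ.range := by
    rintro g _ ⟨f, rfl⟩
    refine ⟨fun x => f (g⁻¹ * x), ?_⟩
    rw [hΦ, hΦ, map_sum]
    refine Fintype.sum_equiv (Equiv.mulLeft g⁻¹) _ _ fun a => ?_
    rw [map_smul, ← Module.End.mul_apply, ← map_mul]
    simp
  have hwmem : w ∈ Φ.range := by
    classical
    refine ⟨Pi.single 1 1, ?_⟩
    rw [hΦ, Finset.sum_eq_single 1]
    · simp
    · intro g _ hg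
      simp [hg]
    · simp
  have hsub : ∀ v ∈ Φ.range, v ∈ C := by
    rintro _ ⟨f, rfl⟩
    exact Submodule.sum_mem _ fun g _ => C.smul_mem _ (hC g w hw)
  let _ : MulAction G Φ.range :=
    { smul := fun g v => ⟨ρ g v, hmem g v v.2⟩
      one_smul := fun v => Subtype.ext (by change ρ 1 v.1 = v.1; simp)
      mul_smul := fun a b v => Subtype.ext (by
        change ρ (a * b) v.1 = ρ a (ρ b v.1); simp) }
  have hsmul : ∀ (g : G) (v : Φ.range), ((g • v : Φ.range) : V) = ρ g v := fun _ _ => rfl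
  have hdvd : p ∣ Nat.card Φ.range := by
    have : addOrderOf (⟨w, hwmem⟩ : Φ.range) = p := by
      apply addOrderOf_eq_prime
      · ext
        change p • w = 0
        rw [← Nat.cast_smul_eq_nsmul F, CharP.cast_eq_zero, zero_smul]
      · exact fun h => hw0 (congrArg Subtype.val h)
    exact this.symm.dvd.trans (addOrderOf_dvd_natCard _)
  obtain ⟨b, hb, hb0⟩ := hG.exists_fixed_point_of_prime_dvd_card_of_fixed_point Φ.range hdvd
    (a := 0) fun g => by ext; rw [hsmul]; simp
  refine ⟨b, hsub b b.2, fun h => hb0 (Subtype.ext h.symm), fun g => ?_⟩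
  rw [← hsmul, hb g]

section Weight

/-- The space of vectors on which the subgroup `N` acts through the character `χ`. -/
def weightSpace (ρ : Representation F G V) {N : Subgroup G} (χ : N →* Fˣ) : Submodule F V :=
  ⨅ n : N, Module.End.eigenspace (ρ n) (χ n : F)

theorem mem_weightSpace {ρ : Representation F G V} {N : Subgroup G} {χ : N →* Fˣ} {v : V} :
    v ∈ ρ.weightSpace χ ↔ ∀ n : N, ρ n v = (χ n : F) • v := by
  simp [weightSpace, Submodule.mem_iInf]

end Weight

end Representation

/-- The conjugation action of a group on the characters of a normal subgroup. -/
instance Subgroup.charMulAction {G A : Type*} [Group G] [CommGroup A] (N : Subgroup G) [N.Normal] :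
    MulAction G (N →* A) where
  smul g χ := χ.comp (MulAut.conjNormal g⁻¹).toMonoidHom
  one_smul χ := by
    ext n
    change χ (MulAut.conjNormal 1⁻¹ n) = χ n
    simp
  mul_smul a b χ := by
    ext n
    change χ (MulAut.conjNormal (a * b)⁻¹ n) =
      χ (MulAut.conjNormal b⁻¹ (MulAut.conjNormal a⁻¹ n))
    simp only [mul_inv_rev, map_mul, MulAut.mul_apply]

theorem Subgroup.char_smul_apply {G A : Type*} [Group G] [CommGroup A] {N : Subgroup G} [N.Normal]
    (g : G) (χ : N →* A) (n : N) : (g • χ) n = χ (MulAut.conjNormal g⁻¹ n) := rfl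

namespace Representation

variable {F G V : Type*} [Field F] [Group G] [AddCommGroup V] [Module F V]

theorem apply_mem_weightSpace_smul {ρ : Representation F G V} {N : Subgroup G} [N.Normal]
    {χ : N →* Fˣ} (g : G) {v : V} (hv : v ∈ ρ.weightSpace χ) : ρ g v ∈ ρ.weightSpace (g • χ) := by
  rw [mem_weightSpace] at hv ⊢
  intro n
  rw [Subgroup.char_smul_apply, ← map_smul, ← hv, ← Module.End.mul_apply, ← Module.End.mul_apply,
    ← map_mul, ← map_mul, MulAut.conjNormal_apply]
  congr 2
  group

theorem map_weightSpace {ρ : Representation F G V} {N : Subgroup G} [N.Normal]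
    (χ : N →* Fˣ) (g : G) : (ρ.weightSpace χ).map (ρ g) = ρ.weightSpace (g • χ) := by
  apply le_antisymm
  · rintro _ ⟨v, hv, rfl⟩
    exact apply_mem_weightSpace_smul g hv
  · intro v hv
    refine ⟨ρ g⁻¹ v, ?_, by simp [← Module.End.mul_apply, ← map_mul]⟩
    have := apply_mem_weightSpace_smul g⁻¹ hv
    rwa [inv_smul_smul] at this

/-- Weight spaces lie in the joint generalized eigenspaces of commuting operators, which are
independent for distinct systems of eigenvalues. -/
theorem iSupIndep_weightSpace [FiniteDimensional F V] (ρ : Representation F G V) {N : Subgroup G}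
    (hN : ∀ a b : N, a * b = b * a) :
    iSupIndep fun χ : N →* Fˣ => ρ.weightSpace χ := by
  have h := Module.End.independent_iInf_maxGenEigenspace_of_forall_mapsTo (fun n : N => ρ n)
    fun i j φ => Module.End.mapsTo_maxGenEigenspace_of_comm (by
      change ρ j * ρ i = ρ i * ρ j
      rw [← map_mul, ← map_mul, ← Subgroup.coe_mul, hN]
      rfl) φ
  have hinj : Function.Injective fun (χ : N →* Fˣ) (n : N) => (χ n : F) := fun χ ψ hχ => by
    ext n
    exact congrFun hχ n
  exact (h.comp hinj).mono fun χ => iInf_mono fun n => Module.End.eigenspace_le_maxGenEigenspace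

/-- G permutes the weight spaces over the orbit of `χ`, so their direct sum is invariant and fills
V; all summands have the same dimension. -/
theorem IsIrreducible.finrank_eq_card_orbit_mul [Finite G] [FiniteDimensional F V]
    {ρ : Representation F G V} (hρ : ρ.IsIrreducible) {N : Subgroup G} [N.Normal]
    (hN : ∀ a b : N, a * b = b * a) (χ : N →* Fˣ) (hχ : ρ.weightSpace χ ≠ ⊥) :
    finrank F V = Nat.card (MulAction.orbit G χ) * finrank F (ρ.weightSpace χ) := by
  classical
  have := Fintype.ofFinite G
  have hf : Finite (MulAction.orbit G χ) := Set.finite_range _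
  have := Fintype.ofFinite (MulAction.orbit G χ)
  have hind : iSupIndep fun ω : MulAction.orbit G χ => ρ.weightSpace (ω : N →* Fˣ) :=
    (iSupIndep_weightSpace ρ hN).comp Subtype.val_injective
  have htop : (⨆ ω : MulAction.orbit G χ, ρ.weightSpace (ω : N →* Fˣ)) = ⊤ := by
    rw [eq_top_iff, ← hρ.sup_map_eq_top hχ]
    refine Finset.sup_le fun g _ => ?_
    rw [map_weightSpace]
    exact le_iSup (fun ω : MulAction.orbit G χ => ρ.weightSpace (ω : N →* Fˣ)) ⟨g • χ, g, rfl⟩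
  have hint := DirectSum.isInternal_submodule_of_iSupIndep_of_iSup_eq_top hind htop
  rw [← (LinearEquiv.ofBijective (DirectSum.coeLinearMap _) hint).finrank_eq,
    Module.finrank_directSum, Finset.sum_congr rfl fun ω _ => ?_, Finset.sum_const,
    Finset.card_univ, smul_eq_mul, Nat.card_eq_fintype_card]
  obtain ⟨g, hg⟩ := ω.2
  change g • χ = ω at hg
  rw [← hg, ← map_weightSpace]
  exact (Submodule.equivMapOfInjective _ (ρ.apply_bijective g).injective _).finrank_eq.symm

end Representation

/-! ### Groups whose irreducible representations have p-power dimension. -/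

open Representation

/-- All irreducible representations of `A` over `F` have `p`-power dimension. -/
def IrreducibleDimsPPower (p : ℕ) (F A : Type*) [Field F] [Group A] : Prop :=
  ∀ (n : ℕ) (ρ : Representation F A (Fin n → F)), ρ.IsIrreducible → ∃ k : ℕ, n = p ^ k

theorem Representation.IsIrreducible.of_surjective {F G V U B : Type*} [Field F] [Group G]
    [Group B] [AddCommGroup V] [Module F V] [AddCommGroup U] [Module F U]
    {ρ : Representation F G V} (hρ : ρ.IsIrreducible) {σ : Representation F B U}
    (e : V ≃ₗ[F] U) (f : B → G) (hf : Function.Surjective f)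
    (h : ∀ b v, e (ρ (f b) v) = σ b (e v)) : σ.IsIrreducible := by
  rw [isIrreducible_iff_forall_isInvariant] at hρ ⊢
  obtain ⟨hn, hρ⟩ := hρ
  refine ⟨e.symm.toEquiv.nontrivial, fun W hW => ?_⟩
  have hinv : ρ.IsInvariant (W.comap e.toLinearMap) := fun g v hv => by
    obtain ⟨b, rfl⟩ := hf g
    change e (ρ (f b) v) ∈ W
    rw [h]
    exact hW b _ hv
  have hmap := Submodule.map_comap_eq_of_surjective (f := e.toLinearMap) e.surjective W
  rcases hρ _ hinv with h1 | h1
  · left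
    rw [← hmap, h1, Submodule.map_bot]
  · right
    rw [← hmap, h1, Submodule.map_top, LinearMap.range_eq_top]
    exact e.surjective

namespace IrreducibleDimsPPower

variable {p : ℕ} {F A B : Type*} [Field F] [Group A] [Group B]

theorem finrank_eq (hA : IrreducibleDimsPPower p F A) {V : Type*} [AddCommGroup V] [Module F V]
    [FiniteDimensional F V] {ρ : Representation F A V} (hρ : ρ.IsIrreducible) :
    ∃ k : ℕ, finrank F V = p ^ k := by
  let e : V ≃ₗ[F] (Fin (finrank F V) → F) := (Module.finBasis F V).equivFun
  let σ : Representation F A (Fin (finrank F V) → F) :=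
    { toFun := fun a => e.toLinearMap ∘ₗ ρ a ∘ₗ e.symm.toLinearMap
      map_one' := by ext; simp
      map_mul' := fun a b => by ext; simp }
  exact hA _ σ (hρ.of_surjective (σ := σ) e id Function.surjective_id fun b v => by simp [σ])

theorem of_surjective (hA : IrreducibleDimsPPower p F A) (f : A →* B)
    (hf : Function.Surjective f) : IrreducibleDimsPPower p F B := by
  intro n ρ hρ
  refine hA n (ρ.comp f) ?_
  rw [isIrreducible_iff_forall_isInvariant] at hρ ⊢
  refine ⟨hρ.1, fun W hW => hρ.2 W fun b w hw => ?_⟩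
  obtain ⟨a, rfl⟩ := hf b
  exact hW a w hw

theorem of_normal [Fact p.Prime] [Finite A] (hA : IrreducibleDimsPPower p F A) (H : Subgroup A)
    [H.Normal] : IrreducibleDimsPPower p F H := by
  intro n σ hσ
  obtain ⟨W, ρ, f, hρ, hf, hf0⟩ := exists_isIrreducible_of_subgroup hσ
  obtain ⟨k, hk⟩ := hA.finrank_eq hρ
  have hdvd := (hρ.clifford hσ f hf hf0).1
  rw [hk, finrank_fin_fun] at hdvd
  obtain ⟨l, -, hl⟩ := (Nat.dvd_prime_pow Fact.out).1 hdvd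
  exact ⟨l, hl⟩

theorem of_isSubnormal [Fact p.Prime] [Finite A] (hA : IrreducibleDimsPPower p F A)
    {H : Subgroup A} (hH : H.IsSubnormal) : IrreducibleDimsPPower p F H := by
  induction hH with
  | top =>
    let e : A ≃* (⊤ : Subgroup A) := Subgroup.topEquiv.symm
    exact hA.of_surjective e.toMonoidHom e.surjective
  | step H K hle _ hN ih =>
    let e := Subgroup.subgroupOfEquivOfLe hle
    exact (ih.of_normal (H.subgroupOf K)).of_surjective e.toMonoidHom e.surjective

/-- A `p'`-group all of whose irreducible representations in characteristic `p` have `p`-power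
dimension is abelian. -/
theorem mul_comm_of_coprime [Fact p.Prime] [Finite A] [IsAlgClosed F] [CharP F p]
    (hA : IrreducibleDimsPPower p F A) (hcard : (Nat.card A).Coprime p) (a b : A) :
    a * b = b * a := by
  classical
  have hp : p.Prime := Fact.out
  have hne : (Nat.card A : F) ≠ 0 := by
    rw [Ne, CharP.cast_eq_zero_iff F p]
    exact fun h => hp.one_lt.ne' (Nat.Coprime.eq_one_of_dvd hcard.symm h)
  have : NeZero (Nat.card A : F) := ⟨hne⟩
  let ρ : Representation F A (A → F) :=
    { toFun := fun g => LinearMap.funLeft F F fun x => x * g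
      map_one' := by ext; simp [LinearMap.funLeft]
      map_mul' := fun a b => by ext; simp [LinearMap.funLeft, mul_assoc] }
  have hρ : ∀ g f x, ρ g f x = f (x * g) := fun _ _ _ => rfl
  -- In the regular representation, Y collects the vectors on which A acts commutatively. It will be
  -- everything.
  let Y : Submodule F (A → F) := ⨅ a, ⨅ b, LinearMap.eqLocus (ρ (a * b)) (ρ (b * a))
  have hYmem : ∀ v, v ∈ Y ↔ ∀ a b, ρ (a * b) v = ρ (b * a) v := by
    simp [Y, Submodule.mem_iInf, LinearMap.mem_eqLocus]
  have hY : ρ.IsInvariant Y := fun g v hv => by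
    rw [hYmem] at hv ⊢
    intro a b
    have := congrArg (ρ g) (hv (g⁻¹ * a * g) (g⁻¹ * b * g))
    simp only [← Module.End.mul_apply, ← map_mul] at this ⊢
    convert this using 3 <;> group
  have hYtop : Y = ⊤ := by
    -- Maschke's theorem gives a complement. A minimal submodule of it would have dimension a power
    -- of p that is nonzero in `F`, hence 1, and so would lie in Y.
    obtain ⟨C, hC⟩ := exists_isCompl (⟨Y, hY⟩ : Subrepresentation ρ)
    have hinf : Y ⊓ C.toSubmodule = ⊥ := congrArg Subrepresentation.toSubmodule hC.inf_eq_bot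
    have hsup : Y ⊔ C.toSubmodule = ⊤ := congrArg Subrepresentation.toSubmodule hC.sup_eq_top
    suffices h : C.toSubmodule = ⊥ by rwa [h, sup_bot_eq] at hsup
    by_contra hC0
    obtain ⟨W, hWC, hW⟩ := exists_isMinimalInvariant_le ρ _ C.apply_mem_toSubmodule hC0
    have hirr := hW.isIrreducible
    obtain ⟨k, hk⟩ := hA.finrank_eq hirr
    have h1 := hirr.finrank_cast_ne_zero hne
    change (finrank F W : F) ≠ 0 at h1
    change finrank F W = p ^ k at hk
    have hk0 : k = 0 := by
      by_contra hk0
      rw [hk, Nat.cast_pow, CharP.cast_eq_zero, zero_pow hk0] at h1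
      exact h1 rfl
    rw [hk0, pow_zero] at hk
    obtain ⟨w, hw0, hw⟩ := finrank_eq_one_iff'.1 hk
    apply hW.ne_bot
    rw [eq_bot_iff, ← hinf]
    refine le_inf (fun v hv => (hYmem v).2 fun a b => ?_) hWC
    have hscal : ∀ g, ∃ c : F, ∀ v ∈ W, ρ g v = c • v := fun g => by
      obtain ⟨c, hc⟩ := hw ⟨ρ g w, hW.inv g w w.2⟩
      refine ⟨c, fun v hv => ?_⟩
      obtain ⟨d, hd⟩ := hw ⟨v, hv⟩
      have hd' : d • (w : A → F) = v := congrArg Subtype.val hd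
      have hc' : c • (w : A → F) = ρ g w := congrArg Subtype.val hc
      rw [← hd', map_smul, ← hc', smul_comm]
    obtain ⟨c, hc⟩ := hscal a
    obtain ⟨d, hd⟩ := hscal b
    rw [map_mul, map_mul, Module.End.mul_apply, Module.End.mul_apply, hd v hv, hc v hv, map_smul,
      map_smul, hc v hv, hd v hv, smul_comm]
  have h := (hYmem (Pi.single (a * b) 1)).1 (hYtop ▸ Submodule.mem_top) a b
  have h1 := congrFun h 1
  rw [hρ, hρ, one_mul, one_mul, Pi.single_eq_same] at h1
  by_contra hab
  rw [Pi.single_eq_of_ne (Ne.symm hab)] at h1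
  exact one_ne_zero h1

end IrreducibleDimsPPower

end

section

open Representation

/-! ### Orders and indices of the cores. -/

section Cores

variable {p : ℕ} {G : Type*} [Group G]

theorem Subgroup.coprime_card_sup [Finite G] {A B : Subgroup G} [B.Normal]
    (hA : (Nat.card A).Coprime p) (hB : (Nat.card B).Coprime p) :
    (Nat.card (A ⊔ B : Subgroup G)).Coprime p := by
  have h1 : Nat.card B * B.relIndex (A ⊔ B) = Nat.card (A ⊔ B : Subgroup G) := by
    rw [← Subgroup.relIndex_bot_left, ← Subgroup.relIndex_bot_left,
      Subgroup.relIndex_mul_relIndex _ _ _ bot_le le_sup_right]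
  rw [← h1, Subgroup.relIndex_sup_right]
  exact hB.mul_left (hA.coprime_dvd_left (Subgroup.relIndex_dvd_card _ _))

theorem coprime_card_pPrimeCore [Finite G] : (Nat.card (pPrimeCore p G)).Coprime p := by
  have hs : SupClosed {N : Subgroup G | N.Normal ∧ (Nat.card N).Coprime p} := by
    rintro A ⟨hA, hA'⟩ B ⟨hB, hB'⟩
    exact ⟨inferInstance, Subgroup.coprime_card_sup hA' hB'⟩
  exact (hs.sSup_mem (Set.toFinite _) ⟨inferInstance, by simp⟩ subset_rfl).2

theorem isPGroup_pCore [Finite G] : IsPGroup p (pCore p G) := by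
  have hs : SupClosed {N : Subgroup G | N.Normal ∧ IsPGroup p N} := by
    rintro A ⟨hA, hA'⟩ B ⟨hB, hB'⟩
    exact ⟨inferInstance, hA'.to_sup_of_normal_right hB'⟩
  exact (hs.sSup_mem (Set.toFinite _) ⟨inferInstance, IsPGroup.of_bot⟩ subset_rfl).2

theorem exists_pow_mem_pPrimeCore [Finite G] {m : G} (hm : m ∈ pPrimePCore p G) :
    ∃ k : ℕ, m ^ p ^ k ∈ pPrimeCore p G := by
  obtain ⟨k, hk⟩ := isPGroup_pCore (p := p) ⟨_, Subgroup.mem_comap.1 hm⟩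
  refine ⟨k, (QuotientGroup.eq_one_iff _).1 ?_⟩
  exact congrArg Subtype.val hk

theorem coprime_index_pPrimePCore [Finite G] (hG : pPrimePPPrimeCore p G = ⊤) :
    (pPrimePCore p G).index.Coprime p := by
  have h : pPrimeCore p (G ⧸ pPrimePCore p G) = ⊤ := by
    rw [eq_top_iff]
    rintro ⟨x⟩ -
    have : x ∈ pPrimePPPrimeCore p G := hG ▸ Subgroup.mem_top x
    exact this
  have h2 := coprime_card_pPrimeCore (p := p) (G := G ⧸ pPrimePCore p G)
  rwa [h, Subgroup.card_top] at h2

end Cores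

/-! ### Comparing numbers of orbits by Burnside's lemma. -/

section Orbits

open MulAction

theorem MulAction.sum_natCard_fixedBy {A X : Type*} [Group A] [Fintype A] [Finite X]
    [MulAction A X] :
    ∑ a : A, Nat.card (fixedBy X a) = Nat.card (orbitRel.Quotient A X) * Nat.card A := by
  classical
  have := Fintype.ofFinite X
  have := Fintype.ofFinite (orbitRel.Quotient A X)
  simp only [Nat.card_eq_fintype_card]
  exact sum_card_fixedBy_eq_card_orbits_mul_card_group A X

theorem MulAction.card_orbits_eq_of_card_fixedBy_eq {A X Y : Type*} [Group A] [Finite A] [Finite X]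
    [Finite Y] [MulAction A X] [MulAction A Y]
    (h : ∀ a : A, Nat.card (fixedBy X a) = Nat.card (fixedBy Y a)) :
    Nat.card (orbitRel.Quotient A X) = Nat.card (orbitRel.Quotient A Y) := by
  have := Fintype.ofFinite A
  apply Nat.eq_of_mul_eq_mul_right (Nat.card_pos (α := A))
  rw [← sum_natCard_fixedBy, ← sum_natCard_fixedBy]
  exact Finset.sum_congr rfl fun a _ => h a

/-- The M-orbits refine the G-orbits, and a surjection between finite sets is injective exactly when
the cardinalities agree. -/
theorem MulAction.forall_exists_smul_eq_iff_card_orbits_eq {G X : Type*} [Group G] [Finite X]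
    [MulAction G X] (M : Subgroup G) :
    (∀ (x : X) (g : G), ∃ m ∈ M, m • x = g • x) ↔
      Nat.card (orbitRel.Quotient M X) = Nat.card (orbitRel.Quotient G X) := by
  have : Finite (orbitRel.Quotient G X) := Quotient.finite _
  have : Finite (orbitRel.Quotient M X) := Quotient.finite _
  let q : orbitRel.Quotient M X → orbitRel.Quotient G X :=
    Quotient.map' id fun a b ⟨m, hm⟩ => ⟨m, hm⟩
  have hq : Function.Surjective q := by
    rintro ⟨x⟩
    exact ⟨Quotient.mk'' x, rfl⟩
  constructor
  · intro h
    refine Nat.card_congr (Equiv.ofBijective q ⟨?_, hq⟩)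
    rintro ⟨x⟩ ⟨y⟩ hxy
    obtain ⟨g, hg⟩ := Quotient.exact hxy
    obtain ⟨m, hm, hmx⟩ := h y g
    exact Quotient.sound ⟨⟨m, hm⟩, hmx.trans hg⟩
  · intro h x g
    have hinj := ((Nat.bijective_iff_surjective_and_card q).2 ⟨hq, h⟩).1
    have hxg : q (Quotient.mk'' (g • x)) = q (Quotient.mk'' x) := Quotient.sound ⟨g, rfl⟩
    obtain ⟨m, hm⟩ := Quotient.exact (hinj hxg)
    exact ⟨m, m.2, hm⟩

end Orbits

/-! ### Brauer's permutation lemma. -/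

section Brauer

/-- An endomorphism of a finite abelian group fixes as many elements as characters. -/
theorem MonoidHom.card_fixedPoints_eq_card_fixed_characters {N F : Type*} [CommGroup N] [Finite N]
    [Field F] [HasEnoughRootsOfUnity F (Monoid.exponent N)] (α : N →* N) :
    Nat.card {x // α x = x} = Nat.card {χ : N →* Fˣ // χ.comp α = χ} := by
  -- The fixed points of `α` form the kernel of β, and the fixed characters are those trivial on its
  -- image. Their number is the index of the image, which is the order of the kernel.
  let β : N →* N := α / MonoidHom.id N
  have hβ : ∀ x, β x = α x / x := fun _ => rfl
  have h1 : Nat.card {x // α x = x} = Nat.card β.ker :=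
    Nat.card_congr (Equiv.subtypeEquivRight fun x => by
      rw [MonoidHom.mem_ker, hβ, div_eq_one])
  have h2 : Nat.card {χ : N →* Fˣ // χ.comp α = χ} =
      Nat.card (MonoidHom.domRestrictHom β.range Fˣ).ker :=
    Nat.card_congr (Equiv.subtypeEquivRight fun χ => by
      rw [MonoidHom.mem_ker]
      constructor
      · intro h
        ext ⟨_, x, rfl⟩
        have hx : χ (α x) = χ x := DFunLike.congr_fun h x
        change (χ (β x) : F) = 1
        rw [hβ, map_div, div_eq_one.2 hx, Units.val_one]
      · intro h
        ext x
        have := DFunLike.congr_fun h ⟨β x, x, rfl⟩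
        change χ (β x) = 1 at this
        rw [hβ, map_div, div_eq_one] at this
        exact congrArg Units.val this)
  rw [h1, h2, CommGroup.card_domRestrictHom_ker]
  change _ = β.range.index
  apply Nat.eq_of_mul_eq_mul_right (Nat.card_pos (α := β.range))
  rw [mul_comm β.range.index, Subgroup.card_mul_index, ← Subgroup.index_ker, Subgroup.card_mul_index]

/-- Brauer's permutation lemma: on a normal abelian `p'`-subgroup, the orbits of `G` are orbits of
`M` if and only if the same holds for the characters. -/
theorem Subgroup.forall_conj_eq_iff_forall_char_smul_eq {G F : Type*} [Group G] [Finite G] [Field F]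
    [IsAlgClosed F] (N M : Subgroup G) [N.Normal] (hN : ∀ a b : N, a * b = b * a)
    (hcard : (Nat.card N : F) ≠ 0) :
    (∀ (x : N) (g : G), ∃ m ∈ M, MulAut.conjNormal m x = MulAut.conjNormal g x) ↔
      ∀ (χ : N →* Fˣ) (g : G), ∃ m ∈ M, m • χ = g • χ := by
  let _ : CommGroup N := { (inferInstance : Group N) with mul_comm := hN }
  have : NeZero (Monoid.exponent N : F) := ⟨fun h => hcard (by
    obtain ⟨c, hc⟩ := Group.exponent_dvd_nat_card (G := N)
    rw [hc, Nat.cast_mul, h, zero_mul])⟩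
  let _ : MulAction G N := MulAction.compHom N (MulAut.conjNormal : G →* MulAut N)
  have hfin : Finite (N →* Fˣ) := by
    apply Nat.finite_of_card_ne_zero
    rw [CommGroup.card_monoidHom_of_hasEnoughRootsOfUnity]
    exact Nat.card_pos.ne'
  have key : ∀ g : G, Nat.card (MulAction.fixedBy N g) =
      Nat.card (MulAction.fixedBy (N →* Fˣ) g) := by
    intro g
    have h := MonoidHom.card_fixedPoints_eq_card_fixed_characters (F := F)
      (MulAut.conjNormal (H := N) g⁻¹).toMonoidHom
    refine Eq.trans (Nat.card_congr (Equiv.subtypeEquivRight fun x => ?_)) h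
    change g • x = x ↔ g⁻¹ • x = x
    -- The action on characters composes with conjugation by g⁻¹, but g and g⁻¹ fix the same
    -- elements.
    rw [inv_smul_eq_iff, eq_comm]
  have hG := MulAction.card_orbits_eq_of_card_fixedBy_eq (A := G) key
  have hM := MulAction.card_orbits_eq_of_card_fixedBy_eq (A := M) (X := N) (Y := N →* Fˣ)
    fun m => key m
  refine (MulAction.forall_exists_smul_eq_iff_card_orbits_eq (X := N) M).trans
    (Iff.trans ?_ (MulAction.forall_exists_smul_eq_iff_card_orbits_eq (X := N →* Fˣ) M).symm)
  rw [hG, hM]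

end Brauer

/-! ### A transfer for characters of M ∩ T. -/

section Transfer

open MulAction

/-- A variant of the transfer of a character `μ` of `M ⊓ stabilizer G ω₀`, which is extended to the
stabilizer acting on `M` by conjugation. -/
theorem exists_hom_mul_eq_pow {G Ω A : Type*} [Group G] [MulAction G Ω] [Finite Ω] [CommGroup A]
    {ω₀ : Ω} {T : Subgroup G} (hT : stabilizer G ω₀ = T) (M : Subgroup G) [hMn : M.Normal]
    (hM : ∀ ω, ∃ m ∈ M, m • ω₀ = ω) (μ : G → A)
    (hmul : ∀ x ∈ M ⊓ T, ∀ y ∈ M ⊓ T, μ (x * y) = μ x * μ y)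
    (hconj : ∀ t ∈ T, ∀ x ∈ M ⊓ T, μ (t * x * t⁻¹) = μ x) :
    ∃ (τ : M →* A) (f : T →* A), ∀ (t : G) (h : t ∈ M) (h' : t ∈ T),
      (μ t⁻¹) ^ Nat.card Ω = τ ⟨t, h⟩⁻¹ * f ⟨t, h'⟩ := by
  subst hT
  have := Fintype.ofFinite Ω
  choose r hrM hr using hM
  -- The semidirect product of M by T acts on Ω by (m, t)ω = mtω, with r(ω) in M as coset
  -- representatives. Here e is the M-component of the transfer factor of (m, t). The conjugation
  -- invariance of μ lets it extend trivially over T, which makes Φ multiplicative.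
  let e : G → G → Ω → G := fun m t ω => (r (m • t • ω))⁻¹ * m * (t * r ω * t⁻¹)
  have he : ∀ m ∈ M, ∀ t ∈ stabilizer G ω₀, ∀ ω, e m t ω ∈ M ⊓ stabilizer G ω₀ := by
    intro m hm t ht ω
    have ht' : t⁻¹ • ω₀ = ω₀ := inv_smul_eq_iff.2 (mem_stabilizer_iff.1 ht).symm
    refine ⟨M.mul_mem (M.mul_mem (M.inv_mem (hrM _)) hm) (hMn.conj_mem _ (hrM _) _), ?_⟩
    change e m t ω • ω₀ = ω₀
    simp only [e, mul_smul, ht', hr]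
    rw [inv_smul_eq_iff, hr]
  let Φ : G → G → A := fun m t => ∏ ω, μ (e m t ω)
  have hΦ : ∀ m ∈ M, ∀ t ∈ stabilizer G ω₀, ∀ m' ∈ M, ∀ t' ∈ stabilizer G ω₀,
      Φ (m * (t * m' * t⁻¹)) (t * t') = Φ m t * Φ m' t' := by
    intro m hm t ht m' hm' t' ht'
    have h1 : ∀ ω, e (m * (t * m' * t⁻¹)) (t * t') ω =
        e m t (m' • t' • ω) * (t * e m' t' ω * t⁻¹) := fun ω => by
      have : (m * (t * m' * t⁻¹)) • (t * t') • ω = m • t • m' • t' • ω := by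
        simp only [← mul_smul]
        congr 1
        group
      simp only [e, this]
      group
    have h2 : ∀ ω, μ (e (m * (t * m' * t⁻¹)) (t * t') ω) =
        μ (e m t (m' • t' • ω)) * μ (e m' t' ω) := fun ω => by
      have hx := he m' hm' t' ht' ω
      rw [h1, hmul _ (he m hm t ht _) _ ⟨hMn.conj_mem _ hx.1 _,
        (stabilizer G ω₀).mul_mem ((stabilizer G ω₀).mul_mem ht hx.2)
          ((stabilizer G ω₀).inv_mem ht)⟩, hconj t ht _ hx]
    simp only [Φ, h2, Finset.prod_mul_distrib]
    congr 1
    exact Fintype.prod_equiv ((MulAction.toPerm t').trans (MulAction.toPerm m')) _ _ fun ω => rfl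
  let τ : M →* A := MonoidHom.mk' (fun m => Φ m 1) fun a b => by
    simpa using hΦ a a.2 1 (one_mem _) b b.2 1 (one_mem _)
  let f : stabilizer G ω₀ →* A := MonoidHom.mk' (fun t => Φ 1 t) fun a b => by
    simpa using hΦ 1 (one_mem _) a a.2 1 (one_mem _) b b.2
  refine ⟨τ, f, fun t h h' => ?_⟩
  have h3 : Φ t⁻¹ t = Φ t⁻¹ 1 * Φ 1 t := by
    simpa using hΦ t⁻¹ (inv_mem h) 1 (one_mem _) 1 (one_mem _) t h'
  -- The pair (t⁻¹, t) acts trivially on Ω and each of its factors is t⁻¹ itself.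
  have h4 : Φ t⁻¹ t = μ t⁻¹ ^ Nat.card Ω := by
    have : ∀ ω, e t⁻¹ t ω = t⁻¹ := fun ω => by
      simp only [e, inv_smul_smul]
      group
    simp only [Φ, this, Finset.prod_const, Finset.card_univ, Nat.card_eq_fintype_card]
  rw [← h4, h3]
  rfl

end Transfer

/-- A finite group with a normal subgroup of `p`-power index is the product of that subgroup and a
Sylow `p`-subgroup. -/
theorem Sylow.exists_eq_mul_of_forall_pow_mem {p : ℕ} [Fact p.Prime] {K : Type*} [Group K]
    [Finite K] (N : Subgroup K) [N.Normal] (h : ∀ x, ∃ k : ℕ, x ^ p ^ k ∈ N) (P : Sylow p K)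
    (x : K) : ∃ n ∈ N, ∃ y ∈ P, x = n * y := by
  have hq : IsPGroup p (K ⧸ N) := by
    rintro ⟨x⟩
    obtain ⟨k, hk⟩ := h x
    exact ⟨k, (QuotientGroup.eq_one_iff _).2 hk⟩
  obtain ⟨n, hn⟩ := IsPGroup.iff_card.1 hq
  have htop : N ⊔ (P : Subgroup K) = ⊤ := by
    rw [← Subgroup.index_eq_one]
    have h1 : (N ⊔ (P : Subgroup K)).index ∣ p ^ n := hn ▸ Subgroup.index_dvd_of_le le_sup_left
    have h2 : (N ⊔ (P : Subgroup K)).index ∣ (P : Subgroup K).index :=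
      Subgroup.index_dvd_of_le le_sup_right
    have h3 : (p ^ n).Coprime (P : Subgroup K).index :=
      Nat.Coprime.pow_left _ (((Fact.out : p.Prime).coprime_iff_not_dvd).2 P.not_dvd_index)
    exact Nat.eq_one_of_dvd_coprimes h3 h1 h2
  have hx : x ∈ N ⊔ (P : Subgroup K) := htop ▸ Subgroup.mem_top x
  obtain ⟨n, hn, y, hy, rfl⟩ := Subgroup.mem_sup_of_normal_left.1 hx
  exact ⟨n, hn, y, hy, rfl⟩

end

/-! ### Dimensions of irreducible representations when M is transitive on G-orbits of characters. -/

section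

open Module Representation MulAction

theorem Units.eq_one_of_pow_prime_pow_eq_one {p : ℕ} [Fact p.Prime] {F : Type*} [Field F]
    [CharP F p] (a : Fˣ) (k : ℕ) (h : a ^ p ^ k = 1) : a = 1 := by
  have : ExpChar F p := ExpChar.prime Fact.out
  have h1 : (a : F) ^ p ^ k = 1 := by rw [← Units.val_pow_eq_pow_val, h, Units.val_one]
  have h2 : ((a : F) - 1) ^ p ^ k = 0 := by rw [sub_pow_expChar_pow, h1, one_pow, sub_self]
  exact Units.ext (sub_eq_zero.1 (pow_eq_zero_iff (pow_pos (Fact.out : p.Prime).pos k).ne' |>.1 h2))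

/-- A representation of a group with an abelian subgroup `N` has a nonzero weight space for `N`. -/
theorem Representation.exists_weightSpace_ne_bot {F G V : Type*} [Field F] [IsAlgClosed F] [Group G]
    [AddCommGroup V] [Module F V] [FiniteDimensional F V] [Nontrivial V]
    (ρ : Representation F G V) {N : Subgroup G} (hN : ∀ a b : N, a * b = b * a) :
    ∃ χ : N →* Fˣ, ρ.weightSpace χ ≠ ⊥ := by
  obtain ⟨w, -, hw0, hw⟩ := exists_common_eigenvector (ρ.comp N.subtype) ⊤
    (fun _ _ _ => Submodule.mem_top) top_ne_bot fun a b w _ => by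
      rw [← Module.End.mul_apply, ← Module.End.mul_apply, ← map_mul, ← map_mul, hN]
  choose c hc using hw
  have hinj : ∀ a b : F, a • w = b • w → a = b := fun a b h => smul_left_injective F hw0 h
  let c' : N →* F :=
    { toFun := c
      map_one' := hinj _ _ (by rw [← hc, map_one, one_smul, Module.End.one_apply])
      map_mul' := fun a b => hinj _ _ (by
        rw [← hc, map_mul, Module.End.mul_apply, hc b, map_smul, hc a, smul_smul, mul_comm]) }
  refine ⟨c'.toHomUnits, (Submodule.ne_bot_iff _).2 ⟨w, mem_weightSpace.2 fun n => ?_, hw0⟩⟩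
  exact hc n

/-- This closure contains a Sylow p-subgroup. Condition (a) therefore makes the quotient by it
abelian. -/
theorem Subgroup.index_closure_pElements_coprime {p : ℕ} [Fact p.Prime] {G : Type*} [Group G]
    [Finite G] : (Subgroup.closure {x : G | ∃ k : ℕ, x ^ p ^ k = 1}).index.Coprime p := by
  obtain ⟨P⟩ : Nonempty (Sylow p G) := inferInstance
  have hle : (P : Subgroup G) ≤ Subgroup.closure {x : G | ∃ k : ℕ, x ^ p ^ k = 1} := by
    intro x hx
    obtain ⟨k, hk⟩ := P.isPGroup' ⟨x, hx⟩
    exact Subgroup.subset_closure ⟨k, congrArg Subtype.val hk⟩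
  refine Nat.Coprime.coprime_dvd_left (Subgroup.index_dvd_of_le hle) ?_
  exact (((Fact.out : p.Prime).coprime_iff_not_dvd).2 P.not_dvd_index).symm

instance Subgroup.closure_pElements_normal (p : ℕ) (G : Type*) [Group G] :
    (Subgroup.closure {x : G | ∃ k : ℕ, x ^ p ^ k = 1}).Normal := by
  refine ⟨fun n hn g => ?_⟩
  have hle : Subgroup.closure {x : G | ∃ k : ℕ, x ^ p ^ k = 1} ≤
      (Subgroup.closure {x : G | ∃ k : ℕ, x ^ p ^ k = 1}).comap (MulAut.conj g).toMonoidHom := by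
    rw [Subgroup.closure_le]
    rintro x ⟨k, hk⟩
    refine Subgroup.subset_closure ⟨k, ?_⟩
    rw [← map_pow, hk, map_one]
  exact hle hn

/-- If an irreducible representation contains a vector that is an eigenvector for a subgroup, then
its dimension is at most the index of that subgroup. -/
theorem Representation.IsIrreducible.finrank_le_index {F G V : Type*} [Field F] [Group G]
    [Finite G] [AddCommGroup V] [Module F V] {ρ : Representation F G V}
    (hρ : ρ.IsIrreducible) {T : Subgroup G} {w : V} (hw0 : w ≠ 0)
    (hw : ∀ t ∈ T, ∃ c : F, ρ t w = c • w) : finrank F V ≤ T.index := by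
  have := Fintype.ofFinite G
  have := Fintype.ofFinite (G ⧸ T)
  have htop : Submodule.span F (Set.range fun q : G ⧸ T => ρ q.out w) = ⊤ := by
    rw [eq_top_iff, ← hρ.sup_map_eq_top (W := Submodule.span F {w}) (by simpa using hw0)]
    refine Finset.sup_le fun g _ => ?_
    rw [Submodule.map_span, Set.image_singleton, Submodule.span_singleton_le_iff_mem]
    obtain ⟨t, ht⟩ := QuotientGroup.mk_out_eq_mul T g
    obtain ⟨c, hc⟩ := hw _ (inv_mem t.2)
    have : ρ g w = c • ρ (g : G ⧸ T).out w := by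
      rw [← map_smul, ← hc, ← Module.End.mul_apply, ← map_mul, ht, mul_inv_cancel_right]
    rw [this]
    exact Submodule.smul_mem _ _ (Submodule.subset_span ⟨_, rfl⟩)
  have h := finrank_range_le_card (R := F) fun q : G ⧸ T => ρ q.out w
  rw [Set.finrank, htop, finrank_top] at h
  rwa [Subgroup.index, Nat.card_eq_fintype_card]

/-- If every `G`-orbit of characters of the normal abelian subgroup `N` is an `M`-orbit, `M / N` is
a `p`-group, `G / M` is a `p'`-group and all `p'`-quotients of `G` are abelian, then the irreducible
representations of `G` in characteristic `p` have `p`-power dimension. -/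
theorem Representation.IsIrreducible.finrank_eq_prime_pow {p : ℕ} [Fact p.Prime] {F G V : Type*}
    [Field F] [IsAlgClosed F] [CharP F p] [Group G] [Finite G] [AddCommGroup V] [Module F V]
    [FiniteDimensional F V] {ρ : Representation F G V}
    (hρ : ρ.IsIrreducible) (N M : Subgroup G) [N.Normal] [M.Normal]
    (hN : ∀ a b : N, a * b = b * a)
    (hMN : ∀ m ∈ M, ∃ k : ℕ, m ^ p ^ k ∈ N) (hM : M.index.Coprime p)
    (hab : ∀ L : Subgroup G, L.Normal → L.index.Coprime p → ∀ a b, a * b * a⁻¹ * b⁻¹ ∈ L)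
    (hchar : ∀ (χ : N →* Fˣ) (g : G), ∃ m ∈ M, m • χ = g • χ) :
    ∃ k : ℕ, finrank F V = p ^ k := by
  have hp : p.Prime := Fact.out
  have hVn := ((isIrreducible_iff_forall_isInvariant ρ).1 hρ).1
  obtain ⟨χ, hχ⟩ := ρ.exists_weightSpace_ne_bot hN
  set T := stabilizer G χ with hT
  have hNT : N ≤ T := by
    intro n hn
    rw [hT, mem_stabilizer_iff]
    ext m
    rw [Subgroup.char_smul_apply]
    congr 2
    ext
    have : (⟨n, hn⟩ * m : N) = m * ⟨n, hn⟩ := hN _ _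
    have h2 : n * m = m * n := congrArg Subtype.val this
    rw [MulAut.conjNormal_apply, inv_inv, mul_assoc, ← h2, inv_mul_cancel_left]
  -- the orbit of `χ` has `p`-power length
  have hΩfin : Finite (orbit G χ) := Set.finite_range _
  have hTindex : Nat.card (orbit G χ) = T.index := by
    rw [hT, index_stabilizer, Nat.card_coe_set_eq]
  obtain ⟨a, ha⟩ : ∃ a : ℕ, Nat.card (orbit G χ) = p ^ a := by
    have horb : orbit G χ = orbit M χ := by
      ext ψ
      constructor
      · rintro ⟨g, rfl⟩
        obtain ⟨m, hm, hmg⟩ := hchar χ g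
        exact ⟨⟨m, hm⟩, hmg⟩
      · rintro ⟨m, rfl⟩
        exact ⟨m, rfl⟩
    have hdvd : Nat.card (orbit G χ) ∣ (N.subgroupOf M).index := by
      rw [horb, Nat.card_coe_set_eq, ← index_stabilizer]
      exact Subgroup.index_dvd_of_le fun n hn => hNT hn
    have hq : IsPGroup p (M ⧸ N.subgroupOf M) := by
      rintro ⟨x⟩
      obtain ⟨k, hk⟩ := hMN x x.2
      exact ⟨k, (QuotientGroup.eq_one_iff _).2 hk⟩
    obtain ⟨n, hn⟩ := IsPGroup.iff_card.1 hq
    rw [Subgroup.index, hn] at hdvd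
    obtain ⟨a, -, ha⟩ := (Nat.dvd_prime_pow hp).1 hdvd
    exact ⟨a, ha⟩
  -- the vectors in the weight space fixed by the `p`-elements of `M ⊓ T`
  set K := M ⊓ T
  have hpow : ∀ x : G, ∀ v : V, ∀ c : F, ρ x v = c • v → ∀ k : ℕ, ρ (x ^ k) v = c ^ k • v := by
    intro x v c h k
    induction k with
    | zero => simp
    | succ k ih => rw [pow_succ, map_mul, Module.End.mul_apply, h, map_smul, ih, smul_smul, pow_succ']
  let W : Submodule F V := ρ.weightSpace χ ⊓
    ⨅ x : {x : G // x ∈ K ∧ ∃ k : ℕ, x ^ p ^ k = 1}, LinearMap.eqLocus (ρ x) LinearMap.id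
  have hWmem : ∀ v, v ∈ W ↔ v ∈ ρ.weightSpace χ ∧
      ∀ x ∈ K, (∃ k : ℕ, x ^ p ^ k = 1) → ρ x v = v := by
    intro v
    simp [W, Submodule.mem_iInf, LinearMap.mem_eqLocus]
  obtain ⟨P⟩ : Nonempty (Sylow p K) := inferInstance
  have hKNP : ∀ x ∈ K, ∃ n : N, ∃ y : K, y ∈ P ∧ x = n * y := by
    intro x hx
    obtain ⟨n, hn, y, hy, hxy⟩ := P.exists_eq_mul_of_forall_pow_mem (N.subgroupOf K)
      (fun x => hMN x x.2.1) ⟨x, hx⟩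
    exact ⟨⟨n, hn⟩, y, hy, congrArg Subtype.val hxy⟩
  have hKconj : ∀ t ∈ T, ∀ x ∈ K, t * x * t⁻¹ ∈ K := fun t ht x hx =>
    ⟨Subgroup.Normal.conj_mem inferInstance x hx.1 t, T.mul_mem (T.mul_mem ht hx.2) (T.inv_mem ht)⟩
  have hW0 : W ≠ ⊥ := by
    have hinv : IsInvariant (ρ.comp (K.subtype.comp (P : Subgroup K).subtype))
        (ρ.weightSpace χ) := fun y w hw => by
      have := apply_mem_weightSpace_smul ((y : K) : G) hw
      rwa [mem_stabilizer_iff.1 (y : K).2.2] at this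
    -- The Sylow subgroup P of K fixes a nonzero vector of weight `χ`. A p-element ny of K acts on
    -- it by χ(n), which is then a p-power root of unity, hence 1.
    obtain ⟨w, hw, hw0, hfix⟩ := exists_fixed_vector p P.isPGroup' _ hinv hχ
    refine (Submodule.ne_bot_iff _).2 ⟨w, (hWmem w).2 ⟨hw, ?_⟩, hw0⟩
    rintro x hx ⟨k, hk⟩
    obtain ⟨n, y, hy, rfl⟩ := hKNP x hx
    have hxw : ρ (n * y) w = (χ n : F) • w := by
      rw [map_mul, Module.End.mul_apply, ← mem_weightSpace.1 hw]
      exact congrArg _ (hfix ⟨y, hy⟩)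
    have h1 : χ n ^ p ^ k = 1 := by
      have := hpow _ _ _ hxw (p ^ k)
      rw [hk, map_one, Module.End.one_apply] at this
      ext
      rw [Units.val_pow_eq_pow_val, Units.val_one]
      refine smul_left_injective F hw0 ?_
      simpa using this.symm
    rw [hxw, Units.eq_one_of_pow_prime_pow_eq_one _ k h1, Units.val_one, one_smul]
  have hWT : ∀ t ∈ T, ∀ w ∈ W, ρ t w ∈ W := by
    intro t ht w hw
    rw [hWmem] at hw ⊢
    refine ⟨?_, ?_⟩
    · have := apply_mem_weightSpace_smul t hw.1
      rwa [mem_stabilizer_iff.1 ht] at this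
    · rintro x hx ⟨k, hk⟩
      have h1 := hw.2 (t⁻¹ * x * t) (by simpa using hKconj t⁻¹ (T.inv_mem ht) x hx)
        ⟨k, by simpa [hk] using conj_pow (i := p ^ k) (a := t⁻¹) (b := x)⟩
      have h2 := congrArg (ρ t) h1
      rw [← Module.End.mul_apply, ← map_mul] at h2
      rw [← Module.End.mul_apply, ← map_mul, ← h2]
      congr 2
      group
  -- `M ⊓ T` acts on `W` by scalars
  have hμ : ∀ x, ∃ c : Fˣ, x ∈ K → ∀ w ∈ W, ρ x w = (c : F) • w := by
    intro x
    by_cases hx : x ∈ K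
    · obtain ⟨n, y, hy, rfl⟩ := hKNP x hx
      refine ⟨χ n, fun _ w hw => ?_⟩
      rw [hWmem] at hw
      obtain ⟨k, hk⟩ := P.isPGroup' ⟨y, hy⟩
      have hyk : (y : G) ^ p ^ k = 1 := by
        simpa using congrArg (fun z : P => ((z : K) : G)) hk
      rw [map_mul, Module.End.mul_apply, hw.2 y y.2 ⟨k, hyk⟩, mem_weightSpace.1 hw.1]
    · exact ⟨1, fun h => absurd h hx⟩
  choose μ hμ using hμ
  obtain ⟨w₀, hw₀, hw₀0⟩ := (Submodule.ne_bot_iff _).1 hW0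
  have hinj : ∀ a b : Fˣ, (a : F) • w₀ = (b : F) • w₀ → a = b := fun a b h =>
    Units.ext (smul_left_injective F hw₀0 h)
  -- The hypothesis on orbits supplies the representatives in M. The character μ is T-invariant
  -- because T preserves W, where K acts by scalars.
  obtain ⟨τ, f, hτf⟩ := exists_hom_mul_eq_pow (Ω := orbit G χ) (ω₀ := ⟨χ, mem_orbit_self χ⟩) (T := T)
    (by
      ext g
      rw [hT, mem_stabilizer_iff, mem_stabilizer_iff]
      exact Subtype.ext_iff) M
    (by
      rintro ⟨_, g, rfl⟩
      obtain ⟨m, hm, hmg⟩ := hchar χ g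
      exact ⟨m, hm, Subtype.ext hmg⟩) μ
    (fun x hx y hy => hinj _ _ (by
      rw [← hμ _ (K.mul_mem hx hy) _ hw₀, map_mul, Module.End.mul_apply, hμ y hy _ hw₀, map_smul,
        hμ x hx _ hw₀, smul_smul, Units.val_mul, mul_comm]))
    (fun t ht x hx => hinj _ _ (by
      have hw' := hWT t⁻¹ (T.inv_mem ht) _ hw₀
      rw [← hμ _ (hKconj t ht x hx) _ hw₀, map_mul, map_mul, Module.End.mul_apply,
        Module.End.mul_apply, hμ x hx _ hw', map_smul, ← Module.End.mul_apply, ← map_mul,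
        mul_inv_cancel, map_one, Module.End.one_apply]))
  -- `T` acts on `W` by commuting operators
  have hpM : ∀ y : G, ∀ k : ℕ, y ^ p ^ k = 1 → y ∈ M := by
    intro y k hy
    rw [← QuotientGroup.eq_one_iff]
    have h1 : (y : G ⧸ M) ^ p ^ k = 1 := by rw [← QuotientGroup.mk_pow, hy, QuotientGroup.mk_one]
    have h2 : (y : G ⧸ M) ^ M.index = 1 := pow_card_eq_one'
    have h3 := pow_gcd_eq_one.2 ⟨h1, h2⟩
    rwa [(Nat.Coprime.pow_left k hM.symm : (p ^ k).gcd M.index = 1), pow_one] at h3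
  -- In characteristic p, `τ` is trivial on p-elements, all of which lie in M. By `hab` the
  -- commutators of G belong to the subgroup they generate, so `τ` kills those of T; `f` kills them
  -- because its target is abelian.
  have hLτ : Subgroup.closure {x : G | ∃ k : ℕ, x ^ p ^ k = 1} ≤ τ.ker.map M.subtype := by
    rw [Subgroup.closure_le]
    rintro y ⟨k, hk⟩
    refine ⟨⟨y, hpM y k hk⟩, ?_, rfl⟩
    apply Units.eq_one_of_pow_prime_pow_eq_one (p := p) _ k
    rw [← map_pow, ← map_one τ]
    congr 1
    exact Subtype.ext hk
  have hcomm : ∀ a ∈ T, ∀ b ∈ T, ∀ w ∈ W, ρ a (ρ b w) = ρ b (ρ a w) := by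
    intro a ha' b hb' w hw
    have hxT : a * b * a⁻¹ * b⁻¹ ∈ T :=
      T.mul_mem (T.mul_mem (T.mul_mem ha' hb') (T.inv_mem ha')) (T.inv_mem hb')
    obtain ⟨⟨x, hxM⟩, hxτ, hx⟩ := hLτ
      (hab _ (Subgroup.closure_pElements_normal p G) Subgroup.index_closure_pElements_coprime a b)
    change x = _ at hx
    subst hx
    have hf : f ⟨_, hxT⟩ = 1 := by
      have : (⟨_, hxT⟩ : T) = ⟨a, ha'⟩ * ⟨b, hb'⟩ * ⟨a, ha'⟩⁻¹ * ⟨b, hb'⟩⁻¹ := rfl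
      rw [this, map_mul, map_mul, map_mul, map_inv, map_inv, mul_inv_cancel_comm, mul_inv_cancel]
    have h1 := hτf _ hxM hxT
    rw [hf, mul_one, map_inv, MonoidHom.mem_ker.1 hxτ, inv_one, ha] at h1
    have h2 := Units.eq_one_of_pow_prime_pow_eq_one _ _ h1
    have h3 := hμ _ (K.inv_mem ⟨hxM, hxT⟩) _ (hWT a ha' _ (hWT b hb' w hw))
    rw [h2, Units.val_one, one_smul] at h3
    rw [← h3]
    simp only [← Module.End.mul_apply, ← map_mul]
    congr 2
    group
  obtain ⟨w, hw, hw0, hwT⟩ := exists_common_eigenvector (ρ.comp T.subtype) W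
    (fun t w hw => hWT t t.2 w hw) hW0 fun a b w hw => hcomm a a.2 b b.2 w hw
  have hle := hρ.finrank_le_index hw0 fun t ht => hwT ⟨t, ht⟩
  have heq := hρ.finrank_eq_card_orbit_mul hN χ hχ
  have hpos : 0 < finrank F (ρ.weightSpace χ) :=
    Nat.pos_of_ne_zero fun h => hχ (Submodule.finrank_eq_zero.1 h)
  refine ⟨a, le_antisymm ?_ ?_⟩
  · rwa [← ha, hTindex]
  · rw [heq, ← ha]
    exact Nat.le_mul_of_pos_right _ hpos

end

/-! ### From Brauer characters to conditions (a) and (b), and back. -/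

section

open Module Representation MulAction

theorem liftRoot_one {F : Type*} [Field F] (θ : CommGroup.torsion Fˣ →* ℂˣ) :
    liftRoot θ (1 : F) = 1 := by
  have h : ∃ u : CommGroup.torsion Fˣ, ((u : Fˣ) : F) = 1 := ⟨1, rfl⟩
  have h1 : h.choose = 1 := Subtype.ext (Units.ext h.choose_spec)
  rw [liftRoot, dif_pos h, h1, map_one, Units.val_one]

theorem brauerCharacter_one (p : ℕ) {G F : Type*} [Group G] [Field F]
    (θ : CommGroup.torsion Fˣ →* ℂˣ) {n : ℕ} (ρ : Representation F G (Fin n → F)) :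
    brauerCharacter p θ ρ 1 = n := by
  have h : ρ (1 : PRegular p G).1 = 1 := map_one ρ
  rw [brauerCharacter, h, LinearMap.charpoly_one, ← Polynomial.C_1, Polynomial.roots_pow,
    Polynomial.roots_X_sub_C, Multiset.nsmul_singleton, Multiset.map_replicate, liftRoot_one,
    Multiset.sum_replicate, finrank_fin_fun, nsmul_eq_mul, mul_one]

theorem forall_mem_IBr_iff (p : ℕ) (G : Type*) {F : Type*} [Group G] [Field F]
    (θ : CommGroup.torsion Fˣ →* ℂˣ) :
    (∀ φ ∈ IBr p G θ, ∃ k : ℕ, φ 1 = (p : ℂ) ^ k) ↔ IrreducibleDimsPPower p F G := by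
  constructor
  · intro h n ρ hρ
    obtain ⟨k, hk⟩ := h _ ⟨n, ρ, hρ, rfl⟩
    rw [brauerCharacter_one] at hk
    exact ⟨k, by exact_mod_cast hk⟩
  · rintro h _ ⟨n, ρ, hρ, rfl⟩
    obtain ⟨k, hk⟩ := h n ρ hρ
    exact ⟨k, by rw [brauerCharacter_one]; exact_mod_cast hk⟩

theorem IrreducibleDimsPPower.subnormalPPrimeSectionsAbelian {p : ℕ} [Fact p.Prime] {F G : Type*}
    [Field F] [IsAlgClosed F] [CharP F p] [Group G] [Finite G] (h : IrreducibleDimsPPower p F G) :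
    SubnormalPPrimeSectionsAbelian p G := fun H K hH _ _ hcop =>
  ((h.of_isSubnormal hH).of_surjective (QuotientGroup.mk' (K.subgroupOf H))
    (QuotientGroup.mk'_surjective _)).mul_comm_of_coprime hcop

theorem SubnormalPPrimeSectionsAbelian.normal {p : ℕ} {G : Type*} [Group G]
    (h : SubnormalPPrimeSectionsAbelian p G) : NormalPPrimeSectionsAbelian p G :=
  fun H K hH _ hle _ => h H K hH.isSubnormal hle inferInstance

theorem NormalPPrimeSectionsAbelian.commutator_mem {p : ℕ} {G : Type*} [Group G]
    (h : NormalPPrimeSectionsAbelian p G) {H K : Subgroup G} [hH : H.Normal] [hK : K.Normal]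
    (hle : K ≤ H) (hcop : (K.relIndex H).Coprime p) {a b : G} (ha : a ∈ H) (hb : b ∈ H) :
    a * b * a⁻¹ * b⁻¹ ∈ K := by
  have h1 := h H K hH hK hle inferInstance hcop (⟨a, ha⟩ : H) (⟨b, hb⟩ : H)
  have h2 : ((⟨a, ha⟩ * ⟨b, hb⟩ * ⟨a, ha⟩⁻¹ * ⟨b, hb⟩⁻¹ : H) : H ⧸ K.subgroupOf H) = 1 := by
    rw [QuotientGroup.mk_mul, QuotientGroup.mk_mul, QuotientGroup.mk_mul, h1, QuotientGroup.mk_inv,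
      QuotientGroup.mk_inv, mul_inv_cancel_right, mul_inv_cancel]
  exact (QuotientGroup.eq_one_iff (N := K.subgroupOf H) _).1 h2

theorem NormalPPrimeSectionsAbelian.pPrimeCore_mul_comm {p : ℕ} {G : Type*} [Group G] [Finite G]
    (h : NormalPPrimeSectionsAbelian p G) (a b : pPrimeCore p G) : a * b = b * a := by
  have h1 := h.commutator_mem (H := pPrimeCore p G) (K := ⊥) bot_le
    (by rw [Subgroup.relIndex_bot_left]; exact coprime_card_pPrimeCore) a.2 b.2
  rw [Subgroup.mem_bot, mul_inv_eq_one, mul_inv_eq_iff_eq_mul] at h1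
  exact Subtype.ext h1

section

variable {p : ℕ} [Fact p.Prime] {F G : Type*} [Field F] [IsAlgClosed F] [CharP F p] [Group G]
  [Finite G]

/-- This recasts (b) as equality of conjugation orbits under G and O_{p',p}(G), the form to which
Brauer's permutation lemma applies. -/
theorem eqCentralizerMulPPrimePCore_iff {p : ℕ} {G : Type*} [Group G] :
    EqCentralizerMulPPrimePCore p G ↔ ∀ (x : pPrimeCore p G) (g : G), ∃ m ∈ pPrimePCore p G,
      MulAut.conjNormal m x = MulAut.conjNormal g x := by
  constructor
  · intro h x g
    obtain ⟨c, hc, m, hm, hcm⟩ := Set.eq_univ_iff_forall.1 (h x x.2) g⁻¹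
    refine ⟨m⁻¹, inv_mem hm, Subtype.ext ?_⟩
    have hcx : x * c = c * x := Subgroup.mem_centralizer_singleton_iff.1 hc |>.symm
    have hg : g = m⁻¹ * c⁻¹ := by
      rw [← mul_inv_rev, eq_comm, inv_eq_iff_eq_inv]
      exact hcm
    rw [MulAut.conjNormal_apply, MulAut.conjNormal_apply, hg]
    have : c⁻¹ * x * c = x := by rw [mul_assoc, hcx, inv_mul_cancel_left]
    calc m⁻¹ * (x : G) * m⁻¹⁻¹ = m⁻¹ * (c⁻¹ * x * c) * m⁻¹⁻¹ := by rw [this]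
      _ = _ := by group
  · intro h x hx
    rw [Set.eq_univ_iff_forall]
    intro g
    obtain ⟨m, hm, hmg⟩ := h ⟨x, hx⟩ g⁻¹
    have h1 := congrArg Subtype.val hmg
    rw [MulAut.conjNormal_apply, MulAut.conjNormal_apply] at h1
    refine ⟨g * m, Subgroup.mem_centralizer_singleton_iff.2 ?_, m⁻¹, inv_mem hm, by simp⟩
    change m * x * m⁻¹ = g⁻¹ * x * g⁻¹⁻¹ at h1
    calc g * m * x = g * (m * x * m⁻¹) * m := by group
      _ = _ := by rw [h1]; group

theorem natCast_card_pPrimeCore_ne_zero {p : ℕ} [Fact p.Prime] {F G : Type*} [Field F] [CharP F p]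
    [Group G] [Finite G] : (Nat.card (pPrimeCore p G) : F) ≠ 0 := by
  rw [Ne, CharP.cast_eq_zero_iff F p]
  exact fun h => (Fact.out : p.Prime).one_lt.ne'
    (Nat.Coprime.eq_one_of_dvd coprime_card_pPrimeCore.symm h)

/-- Coinduction gives an irreducible representation with χ as a quotient over N; Clifford's theorem
lifts this quotient to a submodule, whose vectors have weight χ. -/
theorem Representation.exists_isIrreducible_weightSpace_ne_bot {F G : Type*} [Field F] [Group G]
    [Finite G] {N : Subgroup G} [N.Normal] (χ : N →* Fˣ) :
    ∃ (W : Submodule F (G → F)) (ρ : Representation F G W), ρ.IsIrreducible ∧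
      ρ.weightSpace χ ≠ ⊥ := by
  let σ : Representation F N F :=
    { toFun := fun n => (χ n : F) • LinearMap.id
      map_one' := by ext; simp
      map_mul' := fun a b => by ext; simp [mul_comm] }
  have hσ : σ.IsIrreducible := by
    rw [isIrreducible_iff_forall_isInvariant]
    exact ⟨inferInstance, fun W _ => eq_bot_or_eq_top W⟩
  obtain ⟨W, ρ, f, hρ, hf, hf0⟩ := exists_isIrreducible_of_subgroup hσ
  obtain ⟨-, Y, hY, hinj, hsurj⟩ := hρ.clifford hσ f hf hf0
  obtain ⟨w, hw, hfw⟩ := hsurj 1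
  refine ⟨W, ρ, hρ, (Submodule.ne_bot_iff _).2 ⟨w, mem_weightSpace.2 fun n => ?_, fun h0 => ?_⟩⟩
  · rw [← sub_eq_zero]
    apply hinj _ (Y.sub_mem (hY n w hw) (Y.smul_mem _ hw))
    rw [map_sub, map_smul, sub_eq_zero]
    exact hf n w
  · rw [h0, map_zero] at hfw
    exact zero_ne_one hfw

theorem IrreducibleDimsPPower.eqCentralizerMulPPrimePCore (h : IrreducibleDimsPPower p F G)
    (hG : pPrimePPPrimeCore p G = ⊤) : EqCentralizerMulPPrimePCore p G := by
  have hN := h.subnormalPPrimeSectionsAbelian.normal.pPrimeCore_mul_comm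
  rw [eqCentralizerMulPPrimePCore_iff, Subgroup.forall_conj_eq_iff_forall_char_smul_eq (F := F) _ _
    hN natCast_card_pPrimeCore_ne_zero]
  intro χ g
  obtain ⟨W, ρ, hρ, hχ⟩ := exists_isIrreducible_weightSpace_ne_bot χ
  obtain ⟨k, hk⟩ := h.finrank_eq hρ
  have hdvd := Dvd.intro _ (hρ.finrank_eq_card_orbit_mul hN χ hχ).symm
  rw [hk, Nat.card_coe_set_eq, ← index_stabilizer] at hdvd
  -- The index of the join divides both the p-power orbit length and |G:O_{p',p}(G)|, which is prime
  -- to p.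
  have htop : pPrimePCore p G ⊔ stabilizer G χ = ⊤ := by
    rw [← Subgroup.index_eq_one]
    exact Nat.eq_one_of_dvd_coprimes (Nat.Coprime.pow_left k (coprime_index_pPrimePCore hG).symm)
      ((Subgroup.index_dvd_of_le le_sup_right).trans hdvd)
      (Subgroup.index_dvd_of_le le_sup_left)
  have hg : g ∈ pPrimePCore p G ⊔ stabilizer G χ := htop ▸ Subgroup.mem_top g
  obtain ⟨m, hm, t, ht, rfl⟩ := Subgroup.mem_sup_of_normal_left.1 hg
  exact ⟨m, hm, by rw [mul_smul, mem_stabilizer_iff.1 ht]⟩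

theorem NormalPPrimeSectionsAbelian.irreducibleDimsPPower (h : NormalPPrimeSectionsAbelian p G)
    (h' : EqCentralizerMulPPrimePCore p G) (hG : pPrimePPPrimeCore p G = ⊤) :
    IrreducibleDimsPPower p F G := by
  intro n ρ hρ
  have hN := h.pPrimeCore_mul_comm
  rw [eqCentralizerMulPPrimePCore_iff, Subgroup.forall_conj_eq_iff_forall_char_smul_eq (F := F) _ _
    hN natCast_card_pPrimeCore_ne_zero] at h'
  obtain ⟨k, hk⟩ := hρ.finrank_eq_prime_pow (p := p) _ _ hN (fun m => exists_pow_mem_pPrimeCore)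
    (coprime_index_pPrimePCore hG) (fun L hL hcop a b => h.commutator_mem (H := ⊤) (K := L) le_top
      (by rwa [Subgroup.relIndex_top_right]) (Subgroup.mem_top a) (Subgroup.mem_top b)) h'
  exact ⟨k, by rw [← hk, finrank_fin_fun]⟩

end

end

theorem mainTheorem8 (p : ℕ) [Fact p.Prime] (G : Type*) [Group G] [Finite G]
    (F : Type*) [Field F] [IsAlgClosed F] [CharP F p]
    (θ : CommGroup.torsion Fˣ →* ℂˣ) (hθ : Function.Injective θ)
    (hG : pPrimePPPrimeCore p G = ⊤) :
    ((∀ φ ∈ IBr p G θ, ∃ k : ℕ, φ 1 = (p : ℂ) ^ k) ↔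
      (SubnormalPPrimeSectionsAbelian p G ∧ EqCentralizerMulPPrimePCore p G)) ∧
    ((∀ φ ∈ IBr p G θ, ∃ k : ℕ, φ 1 = (p : ℂ) ^ k) ↔
      (NormalPPrimeSectionsAbelian p G ∧ EqCentralizerMulPPrimePCore p G)) := by
  rw [forall_mem_IBr_iff]
  exact ⟨⟨fun h => ⟨h.subnormalPPrimeSectionsAbelian, h.eqCentralizerMulPPrimePCore hG⟩,
      fun h => h.1.normal.irreducibleDimsPPower h.2 hG⟩,
    ⟨fun h => ⟨h.subnormalPPrimeSectionsAbelian.normal, h.eqCentralizerMulPPrimePCore hG⟩,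
      fun h => h.1.irreducibleDimsPPower h.2 hG⟩⟩
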